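/- Let $\mathcal A$ be a complex Banach algebra (not assumed unital) which is a \emph{dual Banach algebra}: there is a Banach space $\mathcal A_*$ and an identification $\mathcal A\cong(\mathcal A_*)^*$ (an isometric or, more generally, a topological linear isomorphism) such that the multiplication of $\mathcal A$ is separately $\sigma(\mathcal A,\mathcal A_*)$-continuous. The topology $\sigma(\mathcal A,\mathcal A_*)$ is called the weak* topology of $\mathcal A$. A Banach $\mathcal A$-bimodule is a Banach space $E$ with bounded bilinear, associative and mutually commuting left and right actions of $\mathcal A$; its dual $E^*$ is a bimodule via $\langle x,a\cdot\varphi\rangle=\langle x\cdot a,\varphi\rangle$ and $\langle x,\varphi\cdot a\rangle=\langle a\cdot x,\varphi\rangle$. The dual bimodule $E^*$ is \emph{normal} if for every $\varphi\in E^*$ the maps $a\mapsto a\cdot\varphi$ and $a\mapsto\varphi\cdot a$ are weak*-weak* continuous. The algebra $\mathcal A$ is \emph{Connes-amenable} if for every Banach $\mathcal A$-bimodule $E$ with normal dual $E^*$, every bounded weak*-weak* continuous derivation $D:\mathcal A\to E^*$ (that is, $D(ab)=a\cdot D(b)+D(a)\cdot b$) is inner, i.e. $D(a)=a\cdot\varphi-\varphi\cdot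 a$ $(a\in\mathcal A)$ for some $\varphi\in E^*$. For a Banach $\mathcal A$-bimodule $E$ let $\sigma WC(E)$ be the closed sub-bimodule of all $x\in E$ for which $a\mapsto a\cdot x$ and $a\mapsto x\cdot a$ are $\sigma(\mathcal A,\mathcal A_*)$-$\sigma(E,E^*)$-continuous. Let $\mathcal A\hat\otimes\mathcal A$ be the projective tensor product, with $a\cdot(x\otimes y)=ax\otimes y$ and $(x\otimes y)\cdot a=x\otimes ya$, and let $\pi:\mathcal A\hat\otimes\mathcal A\to\mathcal A$, $\pi(x\otimes y)=xy$. The adjoint $\pi^*$ maps $\mathcal A_*$ into $\sigma WC((\mathcal A\hat\otimes\mathcal A)^*)$; let $\pi_{\sigma WC}:\sigma WC((\mathcal A\hat\otimes\mathcal A)^*)^*\to(\mathcal A_*)^*\cong\mathcal A$ be the adjoint of the map $\mathcal A_*\to\sigma WC((\mathcal A\hat\otimes\mathcal A)^*)$ so obtained. The algebra $\mathcal A$ is \emph{Connes-biprojective} if there is a bounded $\mathcal A$-bimodule homomorphism $\rho:\mathcal A\to\sigma WC((\mathcal A\hat\otimes\mathcal A)^*)^*$ with $\pi_{\sigma WC}\circ\rho=\mathrm{id}_{\mathcal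 A}$. Then the following are equivalent: (i) $\mathcal A$ is Connes-biprojective and has a bounded (two-sided) approximate identity; (ii) $\mathcal A$ is Connes-amenable. -/

import Mathlib

open Topology

universe u

noncomputable section

namespace ConnesBiproj

/-! ### Banach bimodules -/

section Bimodule

variable (A : Type*) [NonUnitalNormedRing A] [NormedSpace ℂ A]

/-- The structure of a (normed) `A`-bimodule on a normed space `E`: `left a x` is `a · x` and
`right a x` is `x · a`. Continuity of `left` and `right` says that
`‖a · x‖ ≤ K ‖a‖ ‖x‖` and `‖x · a‖ ≤ K ‖a‖ ‖x‖` for some constant `K`. When `E` is complete this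
is a Banach `A`-bimodule. -/
structure Bimodule (E : Type*) [NormedAddCommGroup E] [NormedSpace ℂ E] where
  /-- `left a x` is `a · x`. -/
  left : A →L[ℂ] E →L[ℂ] E
  /-- `right a x` is `x · a`. -/
  right : A →L[ℂ] E →L[ℂ] E
  left_mul : ∀ a b x, left (a * b) x = left a (left b x)
  right_mul : ∀ a b x, right (a * b) x = right b (right a x)
  right_left : ∀ a b x, right b (left a x) = left a (right b x)

variable {A} {E : Type*} [NormedAddCommGroup E] [NormedSpace ℂ E]

/-- The dual bimodule: `⟨x, a · φ⟩ = ⟨x · a, φ⟩` and `⟨x, φ · a⟩ = ⟨a · x, φ⟩`. -/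
def Bimodule.dual (X : Bimodule A E) : Bimodule A (StrongDual ℂ E) where
  left := (ContinuousLinearMap.compL ℂ E E ℂ).flip ∘L X.right
  right := (ContinuousLinearMap.compL ℂ E E ℂ).flip ∘L X.left
  left_mul a b φ := by ext x; simp [X.right_mul]
  right_mul a b φ := by ext x; simp [X.left_mul]
  right_left a b φ := by ext x; simp [X.right_left]

@[simp] lemma Bimodule.dual_left_apply (X : Bimodule A E) (a : A) (φ : StrongDual ℂ E) (x : E) :
    X.dual.left a φ x = φ (X.right a x) := rfl

@[simp] lemma Bimodule.dual_right_apply (X : Bimodule A E) (a : A) (φ : StrongDual ℂ E) (x : E) :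
    X.dual.right a φ x = φ (X.left a x) := rfl

/-- The restriction of a bimodule structure to a sub-bimodule. -/
def Bimodule.restrict (X : Bimodule A E) (S : Submodule ℂ E)
    (hl : ∀ a, ∀ x ∈ S, X.left a x ∈ S) (hr : ∀ a, ∀ x ∈ S, X.right a x ∈ S) :
    Bimodule A S where
  left := LinearMap.mkContinuous₂
    (LinearMap.mk₂ ℂ (fun a (x : S) => (⟨X.left a x, hl a x x.2⟩ : S))
      (fun _ _ _ => by ext; simp) (fun _ _ _ => by ext; simp)
      (fun _ _ _ => by ext; simp) (fun _ _ _ => by ext; simp))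
    ‖X.left‖ (fun a x => X.left.le_opNorm₂ a x)
  right := LinearMap.mkContinuous₂
    (LinearMap.mk₂ ℂ (fun a (x : S) => (⟨X.right a x, hr a x x.2⟩ : S))
      (fun _ _ _ => by ext; simp) (fun _ _ _ => by ext; simp)
      (fun _ _ _ => by ext; simp) (fun _ _ _ => by ext; simp))
    ‖X.right‖ (fun a x => X.right.le_opNorm₂ a x)
  left_mul a b x := Subtype.ext (X.left_mul a b x)
  right_mul a b x := Subtype.ext (X.right_mul a b x)
  right_left a b x := Subtype.ext (X.right_left a b x)

end Bimodule

/-! ### The projective tensor product `A ⊗̂ A` -/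

section Tensor

variable (A : Type*) [NonUnitalNormedRing A] [NormedSpace ℂ A]

/-- The projective tensor product `A ⊗̂ A`: the completion of the algebraic tensor product for the
projective norm (which is the norm that Mathlib puts on `⨂[ℂ] i, E i`). -/
abbrev ProjTensor : Type _ :=
  UniformSpace.Completion (PiTensorProduct ℂ (fun _ : Fin 2 => A))

variable {A} {G : Type*} [NormedAddCommGroup G] [NormedSpace ℂ G]

/-- A bounded bilinear map as a continuous multilinear map on pairs. -/
def toMultilinear (β : A →L[ℂ] A →L[ℂ] G) :
    ContinuousMultilinearMap ℂ (fun _ : Fin 2 => A) G :=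
  ContinuousLinearMap.uncurryLeft
    (((continuousMultilinearCurryFin1 ℂ A G).symm.toContinuousLinearEquiv :
      (A →L[ℂ] G) →L[ℂ] _) ∘L β)

@[simp] lemma toMultilinear_apply (β : A →L[ℂ] A →L[ℂ] G) (m : Fin 2 → A) :
    toMultilinear β m = β (m 0) (m 1) := rfl

/-- The bounded linear map `A ⊗̂ A → G` induced by a bounded bilinear map `A × A → G`. -/
def ProjTensor.lift [CompleteSpace G] (β : A →L[ℂ] A →L[ℂ] G) : ProjTensor A →L[ℂ] G :=
  (PiTensorProduct.liftIsometry ℂ (fun _ : Fin 2 => A) G (toMultilinear β)).fromCompletion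

variable (A) in
/-- The elementary tensors: `tmul A x y` is `x ⊗ y`. -/
def ProjTensor.tmul : A →L[ℂ] A →L[ℂ] ProjTensor A :=
  (continuousMultilinearCurryFin1 ℂ A (ProjTensor A)).toContinuousLinearEquiv.toContinuousLinearMap
    ∘L (UniformSpace.Completion.toComplL.compContinuousMultilinearMap
      (PiTensorProduct.tprodL ℂ (E := fun _ : Fin 2 => A))).curryLeft

lemma ProjTensor.tmul_apply (x y : A) :
    ProjTensor.tmul A x y = ((PiTensorProduct.tprod ℂ ![x, y] :
        PiTensorProduct ℂ (fun _ : Fin 2 => A)) : ProjTensor A) := by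
  simp [ProjTensor.tmul]

@[simp] lemma ProjTensor.lift_tmul [CompleteSpace G] (β : A →L[ℂ] A →L[ℂ] G) (x y : A) :
    ProjTensor.lift β (ProjTensor.tmul A x y) = β x y := by
  simp [ProjTensor.lift, ProjTensor.tmul_apply]

lemma ProjTensor.ext_tmul {f g : ProjTensor A →L[ℂ] G}
    (h : ∀ x y, f (ProjTensor.tmul A x y) = g (ProjTensor.tmul A x y)) : f = g := by
  have key : f ∘L UniformSpace.Completion.toComplL = g ∘L UniformSpace.Completion.toComplL := by
    apply ContinuousLinearMap.coe_injective
    ext m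
    have hm : m = ![m 0, m 1] := by ext i; fin_cases i <;> rfl
    have := h (m 0) (m 1)
    rw [ProjTensor.tmul_apply, ← hm] at this
    simpa using this
  ext z
  induction z using UniformSpace.Completion.induction_on with
  | hp => exact isClosed_eq f.continuous g.continuous
  | ih z => exact DFunLike.congr_fun key z

variable [IsScalarTower ℂ A A] [SMulCommClass ℂ A A]

variable (A) in
/-- The bimodule structure of `A ⊗̂ A`: `a · (x ⊗ y) = ax ⊗ y` and `(x ⊗ y) · a = x ⊗ ya`. -/
def ProjTensor.bimodule : Bimodule A (ProjTensor A) :=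
  let L : A →L[ℂ] ProjTensor A →L[ℂ] ProjTensor A :=
    (ProjTensor.lift ((ContinuousLinearMap.compL ℂ A A (ProjTensor A)).flip.bilinearComp
      (ContinuousLinearMap.mul ℂ A).flip (ProjTensor.tmul A).flip)).flip
  let R : A →L[ℂ] ProjTensor A →L[ℂ] ProjTensor A :=
    (ProjTensor.lift ((ContinuousLinearMap.compL ℂ A A (ProjTensor A)).bilinearComp
      (ProjTensor.tmul A) (ContinuousLinearMap.mul ℂ A))).flip
  have hL : ∀ a x y, L a (ProjTensor.tmul A x y) = ProjTensor.tmul A (a * x) y := by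
    intro a x y; simp [L]
  have hR : ∀ a x y, R a (ProjTensor.tmul A x y) = ProjTensor.tmul A x (y * a) := by
    intro a x y; simp [R]
  { left := L
    right := R
    left_mul := fun a b => DFunLike.congr_fun
      (ProjTensor.ext_tmul (f := L (a * b)) (g := L a ∘L L b) (by simp [hL, mul_assoc]))
    right_mul := fun a b => DFunLike.congr_fun
      (ProjTensor.ext_tmul (f := R (a * b)) (g := R b ∘L R a) (by simp [hR, mul_assoc]))
    right_left := fun a b => DFunLike.congr_fun
      (ProjTensor.ext_tmul (f := R b ∘L L a) (g := L a ∘L R b) (by simp [hL, hR])) }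

@[simp] lemma ProjTensor.bimodule_left_tmul (a x y : A) :
    (ProjTensor.bimodule A).left a (ProjTensor.tmul A x y) = ProjTensor.tmul A (a * x) y := by
  simp [ProjTensor.bimodule]

@[simp] lemma ProjTensor.bimodule_right_tmul (a x y : A) :
    (ProjTensor.bimodule A).right a (ProjTensor.tmul A x y) = ProjTensor.tmul A x (y * a) := by
  simp [ProjTensor.bimodule]

variable (A) in
/-- The multiplication map `π : A ⊗̂ A → A`, `π (x ⊗ y) = xy`. -/
def mulMap [CompleteSpace A] : ProjTensor A →L[ℂ] A :=
  ProjTensor.lift (ContinuousLinearMap.mul ℂ A)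

@[simp] lemma mulMap_tmul [CompleteSpace A] (x y : A) :
    mulMap A (ProjTensor.tmul A x y) = x * y := by
  simp [mulMap]

lemma mulMap_left [CompleteSpace A] (a : A) (t : ProjTensor A) :
    mulMap A ((ProjTensor.bimodule A).left a t) = a * mulMap A t :=
  DFunLike.congr_fun (ProjTensor.ext_tmul
    (f := mulMap A ∘L (ProjTensor.bimodule A).left a)
    (g := ContinuousLinearMap.mul ℂ A a ∘L mulMap A) (by simp [mul_assoc])) t

lemma mulMap_right [CompleteSpace A] (a : A) (t : ProjTensor A) :
    mulMap A ((ProjTensor.bimodule A).right a t) = mulMap A t * a :=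
  DFunLike.congr_fun (ProjTensor.ext_tmul
    (f := mulMap A ∘L (ProjTensor.bimodule A).right a)
    (g := (ContinuousLinearMap.mul ℂ A).flip a ∘L mulMap A) (by simp [mul_assoc])) t

end Tensor

/-! ### Dual Banach algebras -/

section DualAlgebra

/-- The weak* topology `σ(A, P)` on `A`, for an identification of `A` with the dual of `P`. -/
@[reducible] def weakStar {A P : Type*} [NormedAddCommGroup A] [NormedSpace ℂ A]
    [NormedAddCommGroup P] [NormedSpace ℂ P] (e : A ≃L[ℂ] StrongDual ℂ P) : TopologicalSpace A :=
  TopologicalSpace.induced (fun a => StrongDual.toWeakDual (e a))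
    (inferInstance : TopologicalSpace (WeakDual ℂ P))

/-- `A` is a dual Banach algebra with predual `P`: it is identified with the dual of the Banach
space `P` by a linear homeomorphism (for example by a surjective linear isometry), and the
multiplication is separately `σ(A, P)`-continuous. -/
structure DualBanachAlgebra (A P : Type*) [NonUnitalNormedRing A] [NormedSpace ℂ A]
    [NormedAddCommGroup P] [NormedSpace ℂ P] where
  /-- The identification of `A` with the dual of `P`. -/
  toDual : A ≃L[ℂ] StrongDual ℂ P
  continuous_mul_left : ∀ a : A, Continuous[weakStar toDual, weakStar toDual] fun b => a * b
  continuous_mul_right : ∀ a : A, Continuous[weakStar toDual, weakStar toDual] fun b => b * a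

variable {A P : Type*} [NonUnitalNormedRing A] [NormedSpace ℂ A]
  [NormedAddCommGroup P] [NormedSpace ℂ P]

namespace DualBanachAlgebra

/-- The weak* topology of a dual Banach algebra. -/
@[reducible] def wstar (𝒜 : DualBanachAlgebra A P) : TopologicalSpace A := weakStar 𝒜.toDual

/-- The canonical map of the predual into the dual of `A`. -/
def ofPredual (𝒜 : DualBanachAlgebra A P) : P →L[ℂ] StrongDual ℂ A :=
  (𝒜.toDual : A →L[ℂ] StrongDual ℂ P).flip

@[simp] lemma ofPredual_apply (𝒜 : DualBanachAlgebra A P) (p : P) (a : A) :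
    𝒜.ofPredual p a = 𝒜.toDual a p := rfl

lemma continuous_ofPredual (𝒜 : DualBanachAlgebra A P) (p : P) :
    Continuous[𝒜.wstar, _] (fun a => 𝒜.ofPredual p a) := by
  let _ := 𝒜.wstar
  exact (WeakDual.eval_continuous p).comp continuous_induced_dom

lemma continuous_ofPredual_comp (𝒜 : DualBanachAlgebra A P) (p : P) {g : A → A}
    (hg : Continuous[𝒜.wstar, 𝒜.wstar] g) :
    Continuous[𝒜.wstar, _] (fun a => 𝒜.ofPredual p (g a)) :=
  @Continuous.comp A A ℂ 𝒜.wstar 𝒜.wstar _ g (fun a => 𝒜.ofPredual p a)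
    (𝒜.continuous_ofPredual p) hg

lemma exists_ofPredual_eq (𝒜 : DualBanachAlgebra A P) (f : StrongDual ℂ A)
    (hf : Continuous[𝒜.wstar, _] (fun a => f a)) : ∃ p, 𝒜.ofPredual p = f := by
  have hsymm : @Continuous (WeakDual ℂ P) A _ 𝒜.wstar
      (fun φ => 𝒜.toDual.symm (WeakDual.toStrongDual φ)) := by
    refine continuous_induced_rng.2 ?_
    have : (fun a => StrongDual.toWeakDual (𝒜.toDual a)) ∘
        (fun φ : WeakDual ℂ P => 𝒜.toDual.symm (WeakDual.toStrongDual φ)) = id := by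
      ext φ; simp
    rw [this]
    exact continuous_id
  let g : StrongDual ℂ (WeakBilin (topDualPairing ℂ P)) :=
    { toLinearMap := (f : A →ₗ[ℂ] ℂ) ∘ₗ (𝒜.toDual.symm.toLinearEquiv : _ →ₗ[ℂ] A) ∘ₗ
        (WeakDual.toStrongDual (𝕜 := ℂ) (E := P) : WeakDual ℂ P →ₗ[ℂ] StrongDual ℂ P)
      cont := by
        let _ := 𝒜.wstar
        exact Continuous.comp (g := fun a : A => f a) hf hsymm }
  obtain ⟨p, hp⟩ := LinearMap.dualEmbedding_surjective (topDualPairing ℂ P) g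
  refine ⟨p, ?_⟩
  ext a
  have h := DFunLike.congr_fun hp (StrongDual.toWeakDual (𝒜.toDual a))
  have h2 : g (StrongDual.toWeakDual (𝒜.toDual a)) = f a :=
    congrArg f (𝒜.toDual.symm_apply_apply a)
  exact h.trans h2

/-! ### `σWC` -/

section SigmaWC

variable {E : Type*} [NormedAddCommGroup E] [NormedSpace ℂ E]

/-- `σWC(E)`: the elements `x` of the bimodule `E` for which `a ↦ a · x` and `a ↦ x · a` are
continuous from the weak* topology of `A` to the weak topology `σ(E, E*)` of `E`. -/
def sigmaWC (𝒜 : DualBanachAlgebra A P) (X : Bimodule A E) : Submodule ℂ E where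
  carrier := {x | Continuous[𝒜.wstar, _] (fun a => toWeakSpace ℂ E (X.left a x)) ∧
    Continuous[𝒜.wstar, _] (fun a => toWeakSpace ℂ E (X.right a x))}
  add_mem' {x y} hx hy := by
    let _ := 𝒜.wstar
    refine ⟨?_, ?_⟩
    · simpa only [map_add] using! hx.1.add hy.1
    · simpa only [map_add] using! hx.2.add hy.2
  zero_mem' := by
    let _ := 𝒜.wstar
    refine ⟨?_, ?_⟩
    · simpa only [map_zero] using continuous_const
    · simpa only [map_zero] using continuous_const
  smul_mem' c x hx := by
    let _ := 𝒜.wstar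
    refine ⟨?_, ?_⟩
    · simpa only [map_smul] using! hx.1.const_smul c
    · simpa only [map_smul] using! hx.2.const_smul c

lemma mem_sigmaWC {𝒜 : DualBanachAlgebra A P} {X : Bimodule A E} {x : E} :
    x ∈ 𝒜.sigmaWC X ↔ Continuous[𝒜.wstar, _] (fun a => toWeakSpace ℂ E (X.left a x)) ∧
      Continuous[𝒜.wstar, _] (fun a => toWeakSpace ℂ E (X.right a x)) := Iff.rfl

lemma mem_sigmaWC_of_forall {𝒜 : DualBanachAlgebra A P} {X : Bimodule A E} {x : E}
    (hl : ∀ Φ : StrongDual ℂ E, Continuous[𝒜.wstar, _] (fun a => Φ (X.left a x)))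
    (hr : ∀ Φ : StrongDual ℂ E, Continuous[𝒜.wstar, _] (fun a => Φ (X.right a x))) :
    x ∈ 𝒜.sigmaWC X :=
  ⟨@WeakBilin.continuous_of_continuous_eval A ℂ E (StrongDual ℂ E) _ _ _ _ _ _ _ 𝒜.wstar _ hl,
    @WeakBilin.continuous_of_continuous_eval A ℂ E (StrongDual ℂ E) _ _ _ _ _ _ _ 𝒜.wstar _ hr⟩

lemma left_mem_sigmaWC (𝒜 : DualBanachAlgebra A P) (X : Bimodule A E) (a : A) (x : E)
    (hx : x ∈ 𝒜.sigmaWC X) : X.left a x ∈ 𝒜.sigmaWC X := by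
  have hm := 𝒜.continuous_mul_right a
  change Continuous[𝒜.wstar, 𝒜.wstar] _ at hm
  let _ := 𝒜.wstar
  refine ⟨?_, ?_⟩
  · have := hx.1.comp hm
    simpa only [Function.comp_def, X.left_mul] using this
  · have := (WeakSpace.map (X.left a)).continuous.comp hx.2
    simp only [X.right_left]
    exact this

lemma right_mem_sigmaWC (𝒜 : DualBanachAlgebra A P) (X : Bimodule A E) (a : A) (x : E)
    (hx : x ∈ 𝒜.sigmaWC X) : X.right a x ∈ 𝒜.sigmaWC X := by
  have hm := 𝒜.continuous_mul_left a
  change Continuous[𝒜.wstar, 𝒜.wstar] _ at hm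
  let _ := 𝒜.wstar
  refine ⟨?_, ?_⟩
  · have := (WeakSpace.map (X.right a)).continuous.comp hx.1
    simp only [← X.right_left]
    exact this
  · have := hx.2.comp hm
    simpa only [Function.comp_def, X.right_mul] using this

/-- `σWC(E)` as an `A`-bimodule. -/
def sigmaWCBimodule (𝒜 : DualBanachAlgebra A P) (X : Bimodule A E) :
    Bimodule A (𝒜.sigmaWC X) :=
  X.restrict (𝒜.sigmaWC X) (𝒜.left_mem_sigmaWC X) (𝒜.right_mem_sigmaWC X)

/-- The dual of the bimodule `E` is normal: all maps `a ↦ a · φ` and `a ↦ φ · a`, `φ ∈ E*`, are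
weak*-weak* continuous. -/
def IsNormalDual (𝒜 : DualBanachAlgebra A P) (X : Bimodule A E) : Prop :=
  ∀ φ : StrongDual ℂ E,
    Continuous[𝒜.wstar, _] (fun a => StrongDual.toWeakDual (X.dual.left a φ)) ∧
    Continuous[𝒜.wstar, _] (fun a => StrongDual.toWeakDual (X.dual.right a φ))

end SigmaWC

/-! ### The map `π_σWC` -/

section PiSigmaWC

variable [IsScalarTower ℂ A A] [SMulCommClass ℂ A A] [CompleteSpace A]

/-- `π*` maps the predual into `σWC((A ⊗̂ A)*)`. -/
lemma mulMap_adjoint_mem (𝒜 : DualBanachAlgebra A P) (p : P) :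
    (𝒜.ofPredual p) ∘L mulMap A ∈ 𝒜.sigmaWC (ProjTensor.bimodule A).dual := by
  have hl : ∀ a : A, ∃ q, 𝒜.ofPredual q =
      (𝒜.ofPredual p) ∘L (ContinuousLinearMap.mul ℂ A).flip a := fun a =>
    𝒜.exists_ofPredual_eq _ (𝒜.continuous_ofPredual_comp p (𝒜.continuous_mul_right a))
  have hr : ∀ a : A, ∃ q, 𝒜.ofPredual q =
      (𝒜.ofPredual p) ∘L (ContinuousLinearMap.mul ℂ A) a := fun a =>
    𝒜.exists_ofPredual_eq _ (𝒜.continuous_ofPredual_comp p (𝒜.continuous_mul_left a))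
  have hΦ : ∀ Φ : StrongDual ℂ (StrongDual ℂ (ProjTensor A)), ∃ b : A, ∀ q,
      Φ ((𝒜.ofPredual q) ∘L mulMap A) = 𝒜.ofPredual q b := by
    intro Φ
    refine ⟨𝒜.toDual.symm (Φ ∘L ((ContinuousLinearMap.compL ℂ (ProjTensor A) A ℂ).flip
      (mulMap A)) ∘L 𝒜.ofPredual), fun q => ?_⟩
    simp
  refine mem_sigmaWC_of_forall (fun Φ => ?_) (fun Φ => ?_)
  · obtain ⟨b, hb⟩ := hΦ Φ
    have : (fun a => Φ ((ProjTensor.bimodule A).dual.left a ((𝒜.ofPredual p) ∘L mulMap A))) =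
        fun a => 𝒜.ofPredual p (b * a) := by
      funext a
      obtain ⟨q, hq⟩ := hl a
      have h1 : (ProjTensor.bimodule A).dual.left a ((𝒜.ofPredual p) ∘L mulMap A) =
          (𝒜.ofPredual q) ∘L mulMap A := by
        ext t
        rw [hq]
        simp [mulMap_right]
      rw [h1, hb, hq]
      rfl
    rw [this]
    exact 𝒜.continuous_ofPredual_comp p (𝒜.continuous_mul_left b)
  · obtain ⟨b, hb⟩ := hΦ Φ
    have : (fun a => Φ ((ProjTensor.bimodule A).dual.right a ((𝒜.ofPredual p) ∘L mulMap A))) =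
        fun a => 𝒜.ofPredual p (a * b) := by
      funext a
      obtain ⟨q, hq⟩ := hr a
      have h1 : (ProjTensor.bimodule A).dual.right a ((𝒜.ofPredual p) ∘L mulMap A) =
          (𝒜.ofPredual q) ∘L mulMap A := by
        ext t
        rw [hq]
        simp [mulMap_left]
      rw [h1, hb, hq]
      rfl
    rw [this]
    exact 𝒜.continuous_ofPredual_comp p (𝒜.continuous_mul_right b)

/-- The Banach space `σWC((A ⊗̂ A)*)`. -/
abbrev SWC (𝒜 : DualBanachAlgebra A P) : Type _ :=
  𝒜.sigmaWC (ProjTensor.bimodule A).dual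

/-- The bimodule `σWC((A ⊗̂ A)*)*`. -/
def swcDual (𝒜 : DualBanachAlgebra A P) : Bimodule A (StrongDual ℂ 𝒜.SWC) :=
  (𝒜.sigmaWCBimodule (ProjTensor.bimodule A).dual).dual

/-- The restriction of `π*` to the predual, as a map into `σWC((A ⊗̂ A)*)`. -/
def piStar (𝒜 : DualBanachAlgebra A P) : P →L[ℂ] 𝒜.SWC :=
  (((ContinuousLinearMap.compL ℂ (ProjTensor A) A ℂ).flip (mulMap A)) ∘L 𝒜.ofPredual).codRestrict
    (𝒜.sigmaWC (ProjTensor.bimodule A).dual) 𝒜.mulMap_adjoint_mem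

lemma coe_piStar (𝒜 : DualBanachAlgebra A P) (p : P) :
    (𝒜.piStar p : StrongDual ℂ (ProjTensor A)) = 𝒜.ofPredual p ∘L mulMap A := rfl

/-- `π_σWC : σWC((A ⊗̂ A)*)* → A`, the adjoint of `π* : A_* → σWC((A ⊗̂ A)*)`. -/
def piSWC (𝒜 : DualBanachAlgebra A P) : StrongDual ℂ 𝒜.SWC →L[ℂ] A :=
  (𝒜.toDual.symm : StrongDual ℂ P →L[ℂ] A) ∘L
    (ContinuousLinearMap.compL ℂ P 𝒜.SWC ℂ).flip 𝒜.piStar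

lemma toDual_piSWC (𝒜 : DualBanachAlgebra A P) (M : StrongDual ℂ 𝒜.SWC) (p : P) :
    𝒜.toDual (𝒜.piSWC M) p = M (𝒜.piStar p) := by
  simp [piSWC]

/-- Connes-biprojectivity: `π_σWC` has a bounded right inverse that is a bimodule homomorphism. -/
def IsConnesBiprojective (𝒜 : DualBanachAlgebra A P) : Prop :=
  ∃ ρ : A →L[ℂ] StrongDual ℂ 𝒜.SWC,
    (∀ a b, ρ (a * b) = 𝒜.swcDual.left a (ρ b)) ∧
    (∀ a b, ρ (a * b) = 𝒜.swcDual.right b (ρ a)) ∧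
    ∀ a, 𝒜.piSWC (ρ a) = a

end PiSigmaWC

end DualBanachAlgebra

end DualAlgebra

/-! ### Connes-amenability and bounded approximate identities -/

/-- A bounded linear map `D : A → E` into a bimodule is a derivation:
`D(ab) = a · D(b) + D(a) · b`. -/
def IsDerivation {A E : Type*} [NonUnitalNormedRing A] [NormedSpace ℂ A] [NormedAddCommGroup E]
    [NormedSpace ℂ E] (X : Bimodule A E) (D : A →L[ℂ] E) : Prop :=
  ∀ a b, D (a * b) = X.left a (D b) + X.right b (D a)

/-- Connes-amenability: every weak*-weak* continuous (bounded) derivation of `A` into a normal dual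
Banach `A`-bimodule is inner. -/
def DualBanachAlgebra.IsConnesAmenable {A P : Type u} [NonUnitalNormedRing A] [NormedSpace ℂ A]
    [NormedAddCommGroup P] [NormedSpace ℂ P] (𝒜 : DualBanachAlgebra A P) : Prop :=
  ∀ (F : Type u) [NormedAddCommGroup F] [NormedSpace ℂ F] [CompleteSpace F] (X : Bimodule A F),
    𝒜.IsNormalDual X →
    ∀ D : A →L[ℂ] StrongDual ℂ F, IsDerivation X.dual D →
      Continuous[𝒜.wstar, _] (fun a => StrongDual.toWeakDual (D a)) →
      ∃ φ : StrongDual ℂ F, ∀ a, D a = X.dual.left a φ - X.dual.right a φ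

/-- `A` has a bounded (two-sided) approximate identity. -/
def HasBoundedApproximateIdentity (A : Type*) [NonUnitalNormedRing A] : Prop :=
  ∃ l : Filter A, l.IsApproximateUnit ∧ ∃ C : ℝ, ∀ᶠ e in l, ‖e‖ ≤ C

end ConnesBiproj

end

noncomputable section

namespace ConnesBiproj

/-! ### Quotients of bimodules -/

section Quotient

variable {A : Type*} [NonUnitalNormedRing A] [NormedSpace ℂ A]
  {E : Type*} [NormedAddCommGroup E] [NormedSpace ℂ E]

lemma norm_liftQ_le {G : Type*} [NormedAddCommGroup G] [NormedSpace ℂ G] (K : Submodule ℂ E)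
    (f : E →L[ℂ] G) (h : K ≤ f.ker) (z : E ⧸ K) : ‖K.liftQL f h z‖ ≤ ‖f‖ * ‖z‖ := by
  refine le_of_forall_pos_le_add fun ε hε => ?_
  have hc : 0 < ‖f‖ + 1 := by positivity
  obtain ⟨x, rfl, hx⟩ := Submodule.Quotient.norm_mk_lt z (div_pos hε hc)
  calc ‖f x‖ ≤ ‖f‖ * ‖x‖ := f.le_opNorm x
    _ ≤ ‖f‖ * (‖(Submodule.Quotient.mk x : E ⧸ K)‖ + ε / (‖f‖ + 1)) := by gcongr
    _ ≤ ‖f‖ * ‖(Submodule.Quotient.mk x : E ⧸ K)‖ + ε := by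
      rw [mul_add]
      gcongr
      rw [mul_div_assoc', div_le_iff₀ hc]
      nlinarith

/-- The bounded family of operators on `E ⧸ K` induced by a bounded family of operators on `E`
that leave `K` invariant. -/
def quotientAction (T : A →L[ℂ] E →L[ℂ] E) (K : Submodule ℂ E) [IsClosed (K : Set E)]
    (h : ∀ a, ∀ x ∈ K, T a x ∈ K) : A →L[ℂ] (E ⧸ K) →L[ℂ] (E ⧸ K) :=
  have hK : ∀ a, K ≤ (K.mkQL ∘L T a).ker := fun a x hx => by simpa using h a x hx
  LinearMap.mkContinuous₂
    (LinearMap.mk₂ ℂ (fun a z => K.liftQL (K.mkQL ∘L T a) (hK a) z)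
      (fun a b z => by
        obtain ⟨x, rfl⟩ := K.mkQ_surjective z
        simp [Submodule.liftQL])
      (fun c a z => by
        obtain ⟨x, rfl⟩ := K.mkQ_surjective z
        simp [Submodule.liftQL])
      (fun a y z => map_add _ y z) (fun c a z => map_smul _ c z))
    ‖T‖ (fun a z => by
      refine (norm_liftQ_le K _ (hK a) z).trans ?_
      gcongr
      refine (ContinuousLinearMap.opNorm_le_bound _ (by positivity) fun x => ?_)
      exact (Submodule.Quotient.norm_mk_le _ _).trans (T.le_opNorm₂ a x))

/-- The quotient of a bimodule by a closed sub-bimodule. -/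
def Bimodule.quotient (X : Bimodule A E) (K : Submodule ℂ E) [IsClosed (K : Set E)]
    (hl : ∀ a, ∀ x ∈ K, X.left a x ∈ K) (hr : ∀ a, ∀ x ∈ K, X.right a x ∈ K) :
    Bimodule A (E ⧸ K) where
  left := quotientAction X.left K hl
  right := quotientAction X.right K hr
  left_mul a b z := by
    obtain ⟨x, rfl⟩ := K.mkQ_surjective z
    exact congrArg K.mkQL (X.left_mul a b x)
  right_mul a b z := by
    obtain ⟨x, rfl⟩ := K.mkQ_surjective z
    exact congrArg K.mkQL (X.right_mul a b x)
  right_left a b z := by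
    obtain ⟨x, rfl⟩ := K.mkQ_surjective z
    exact congrArg K.mkQL (X.right_left a b x)

end Quotient

namespace DualBanachAlgebra

section Predual

variable {A P : Type*} [NonUnitalNormedRing A] [NormedSpace ℂ A]
  [NormedAddCommGroup P] [NormedSpace ℂ P]

lemma mem_range_ofPredual_iff (𝒜 : DualBanachAlgebra A P) {f : StrongDual ℂ A} :
    f ∈ 𝒜.ofPredual.range ↔ Continuous[𝒜.wstar, _] (fun a => f a) := by
  refine ⟨?_, fun hf => 𝒜.exists_ofPredual_eq f hf⟩
  rintro ⟨p, rfl⟩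
  exact 𝒜.continuous_ofPredual p

lemma norm_le_norm_ofPredual (𝒜 : DualBanachAlgebra A P) (p : P) :
    ‖p‖ ≤ ‖(𝒜.toDual.symm : StrongDual ℂ P →L[ℂ] A)‖ * ‖𝒜.ofPredual p‖ := by
  refine NormedSpace.norm_le_dual_bound ℂ p (by positivity) fun f => ?_
  calc ‖f p‖ = ‖𝒜.ofPredual p (𝒜.toDual.symm f)‖ := by simp
    _ ≤ ‖𝒜.ofPredual p‖ * ‖𝒜.toDual.symm f‖ := ContinuousLinearMap.le_opNorm _ _
    _ ≤ ‖𝒜.ofPredual p‖ * (‖(𝒜.toDual.symm : StrongDual ℂ P →L[ℂ] A)‖ * ‖f‖) := by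
      gcongr
      exact ContinuousLinearMap.le_opNorm (𝒜.toDual.symm : StrongDual ℂ P →L[ℂ] A) f
    _ = _ := by ring

lemma isClosed_range_ofPredual (𝒜 : DualBanachAlgebra A P) [CompleteSpace P] :
    IsClosed (𝒜.ofPredual.range : Set (StrongDual ℂ A)) := by
  have h : AntilipschitzWith ‖(𝒜.toDual.symm : StrongDual ℂ P →L[ℂ] A)‖₊ 𝒜.ofPredual :=
    ContinuousLinearMap.antilipschitz_of_bound _ 𝒜.norm_le_norm_ofPredual
  exact h.isClosed_range 𝒜.ofPredual.uniformContinuous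

lemma ofPredual_separates (𝒜 : DualBanachAlgebra A P) {a b : A}
    (h : ∀ p, 𝒜.ofPredual p a = 𝒜.ofPredual p b) : a = b :=
  𝒜.toDual.injective (ContinuousLinearMap.ext h)

variable {E : Type*} [NormedAddCommGroup E] [NormedSpace ℂ E]

lemma continuous_toWeakDual_iff (𝒜 : DualBanachAlgebra A P) {g : A → StrongDual ℂ E} :
    Continuous[𝒜.wstar, _] (fun a => StrongDual.toWeakDual (g a)) ↔
      ∀ x, Continuous[𝒜.wstar, _] (fun a => g a x) := by
  let _ := 𝒜.wstar
  exact ⟨fun h x => (WeakDual.eval_continuous x).comp h,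
    fun h => WeakDual.continuous_of_continuous_eval h⟩

lemma continuous_toWeakSpace_iff (𝒜 : DualBanachAlgebra A P) {g : A → E} :
    Continuous[𝒜.wstar, _] (fun a => toWeakSpace ℂ E (g a)) ↔
      ∀ Φ : StrongDual ℂ E, Continuous[𝒜.wstar, _] (fun a => Φ (g a)) := by
  let _ := 𝒜.wstar
  exact ⟨fun h Φ => (WeakBilin.eval_continuous (topDualPairing ℂ E).flip Φ).comp h,
    fun h => WeakBilin.continuous_of_continuous_eval (topDualPairing ℂ E).flip h⟩

lemma mem_sigmaWC_iff {𝒜 : DualBanachAlgebra A P} {X : Bimodule A E} {x : E} :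
    x ∈ 𝒜.sigmaWC X ↔ ∀ Φ : StrongDual ℂ E,
      Φ ∘L X.left.flip x ∈ 𝒜.ofPredual.range ∧ Φ ∘L X.right.flip x ∈ 𝒜.ofPredual.range := by
  simp only [mem_sigmaWC, continuous_toWeakSpace_iff, mem_range_ofPredual_iff, forall_and]
  rfl

lemma isClosed_sigmaWC (𝒜 : DualBanachAlgebra A P) [CompleteSpace P] (X : Bimodule A E) :
    IsClosed (𝒜.sigmaWC X : Set E) := by
  have : (𝒜.sigmaWC X : Set E) = ⋂ Φ : StrongDual ℂ E,
      {x | Φ ∘L X.left.flip x ∈ 𝒜.ofPredual.range} ∩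
        {x | Φ ∘L X.right.flip x ∈ 𝒜.ofPredual.range} := by
    ext x
    simp only [SetLike.mem_coe, mem_sigmaWC_iff, Set.mem_iInter, Set.mem_inter_iff,
      Set.mem_ofPred_eq]
  rw [this]
  exact isClosed_iInter fun Φ =>
    (𝒜.isClosed_range_ofPredual.preimage
      (((ContinuousLinearMap.compL ℂ A E ℂ) Φ) ∘L X.left.flip).continuous).inter
    (𝒜.isClosed_range_ofPredual.preimage
      (((ContinuousLinearMap.compL ℂ A E ℂ) Φ) ∘L X.right.flip).continuous)

lemma isNormalDual_iff {𝒜 : DualBanachAlgebra A P} {X : Bimodule A E} :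
    𝒜.IsNormalDual X ↔ ∀ (φ : StrongDual ℂ E) (x : E),
      Continuous[𝒜.wstar, _] (fun a => φ (X.right a x)) ∧
      Continuous[𝒜.wstar, _] (fun a => φ (X.left a x)) := by
  simp only [IsNormalDual, continuous_toWeakDual_iff, forall_and, Bimodule.dual_left_apply,
    Bimodule.dual_right_apply]

/-- The dual of `σWC(E)` is normal. -/
lemma isNormalDual_sigmaWCBimodule (𝒜 : DualBanachAlgebra A P) (X : Bimodule A E) :
    𝒜.IsNormalDual (𝒜.sigmaWCBimodule X) := by
  refine isNormalDual_iff.2 fun φ x => ?_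
  obtain ⟨Φ, hΦ, -⟩ := exists_extension_norm_eq (𝒜.sigmaWC X) φ
  have h := x.2
  rw [mem_sigmaWC, continuous_toWeakSpace_iff, continuous_toWeakSpace_iff] at h
  refine ⟨?_, ?_⟩
  · simpa only [← hΦ] using! h.2 Φ
  · simpa only [← hΦ] using! h.1 Φ

lemma IsNormalDual.quotient {𝒜 : DualBanachAlgebra A P} {X : Bimodule A E}
    (hX : 𝒜.IsNormalDual X) (K : Submodule ℂ E) [IsClosed (K : Set E)]
    (hl : ∀ a, ∀ x ∈ K, X.left a x ∈ K) (hr : ∀ a, ∀ x ∈ K, X.right a x ∈ K) :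
    𝒜.IsNormalDual (X.quotient K hl hr) := by
  refine isNormalDual_iff.2 fun φ z => ?_
  obtain ⟨x, rfl⟩ := K.mkQ_surjective z
  exact isNormalDual_iff.1 hX (φ ∘L K.mkQL) x

end Predual

/-! ### Identities -/

section Unit

variable {A P : Type*} [NonUnitalNormedRing A] [NormedSpace ℂ A]
  [NormedAddCommGroup P] [NormedSpace ℂ P]

/-- A dual Banach algebra with a bounded approximate identity has an identity. -/
lemma exists_identity_of_approximateIdentity (𝒜 : DualBanachAlgebra A P)
    (h : HasBoundedApproximateIdentity A) : ∃ e : A, ∀ a, e * a = a ∧ a * e = a := by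
  obtain ⟨l, hl, C, hC⟩ := h
  have := hl.neBot
  let U := Ultrafilter.of l
  have hU : (U : Filter A) ≤ l := Ultrafilter.of_le l
  let j : A → WeakDual ℂ P := fun a => StrongDual.toWeakDual (𝒜.toDual a)
  let R := ‖(𝒜.toDual : A →L[ℂ] StrongDual ℂ P)‖ * C
  have hmem : ∀ᶠ a in (U : Filter A),
      j a ∈ WeakDual.toStrongDual ⁻¹' Metric.closedBall (0 : StrongDual ℂ P) R := by
    filter_upwards [hU hC] with a ha
    have : ‖𝒜.toDual a‖ ≤ R :=
      (ContinuousLinearMap.le_opNorm (𝒜.toDual : A →L[ℂ] StrongDual ℂ P) a).trans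
        (mul_le_mul_of_nonneg_left ha (norm_nonneg _))
    simpa [j] using! this
  obtain ⟨ψ, -, hψ⟩ := (WeakDual.isCompact_closedBall (𝕜 := ℂ) (0 : StrongDual ℂ P) R)
    |>.ultrafilter_le_nhds (U.map j) (Filter.le_principal_iff.2 hmem)
  let e : A := 𝒜.toDual.symm (WeakDual.toStrongDual ψ)
  have hje : j e = ψ := by simp [j, e]
  have hlim : Filter.Tendsto id (U : Filter A) (@nhds A 𝒜.wstar e) := by
    rw [nhds_induced, Filter.tendsto_comap_iff]
    change Filter.Tendsto j U (𝓝 (j e))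
    rw [hje]
    exact hψ
  have key : ∀ (g : A → A) (a : A), Continuous[𝒜.wstar, 𝒜.wstar] g →
      Filter.Tendsto g l (𝓝 a) → g e = a := by
    intro g a hg hga
    refine 𝒜.ofPredual_separates fun p => ?_
    have h1 : Filter.Tendsto (fun x => 𝒜.ofPredual p (g x)) U (𝓝 (𝒜.ofPredual p (g e))) := by
      have hc := 𝒜.continuous_ofPredual_comp p hg
      let _ := 𝒜.wstar
      exact (hc.tendsto e).comp hlim
    exact tendsto_nhds_unique h1
      (((𝒜.ofPredual p).continuous.tendsto a).comp (hga.mono_left hU))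
  exact ⟨e, fun a => ⟨key (· * a) a (𝒜.continuous_mul_right a) (hl.tendsto_mul_right a),
    key (a * ·) a (𝒜.continuous_mul_left a) (hl.tendsto_mul_left a)⟩⟩

end Unit

end DualBanachAlgebra

/-- The linear subspaces of `E`, for the module structure that underlies its normed space
structure. This fixes the instances on subspaces of `StrongDual ℂ A`. -/
abbrev NormedSubspace (E : Type*) [NormedAddCommGroup E] [NormedSpace ℂ E] : Type _ :=
  Submodule ℂ E

section Central

variable {A : Type*} [NonUnitalNormedRing A] [NormedSpace ℂ A]
  {E : Type*} [NormedAddCommGroup E] [NormedSpace ℂ E]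

lemma Bimodule.left_mul_of_central (X : Bimodule A E) {x : E}
    (hx : ∀ a, X.left a x = X.right a x) (a b : A) :
    X.left (a * b) x = X.right b (X.left a x) := by
  rw [X.left_mul, hx b, X.right_left]

end Central

section Regular

variable (A : Type*) [NonUnitalNormedRing A] [NormedSpace ℂ A]
  [IsScalarTower ℂ A A] [SMulCommClass ℂ A A]

/-- `A` with the left multiplication and the zero right action. -/
def leftRegular : Bimodule A A where
  left := ContinuousLinearMap.mul ℂ A
  right := 0
  left_mul a b x := by simp [mul_assoc]
  right_mul a b x := by simp
  right_left a b x := by simp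

/-- `A` with the right multiplication and the zero left action. -/
def rightRegular : Bimodule A A where
  left := 0
  right := (ContinuousLinearMap.mul ℂ A).flip
  left_mul a b x := by simp
  right_mul a b x := by simp [mul_assoc]
  right_left a b x := by simp

end Regular

namespace DualBanachAlgebra

section UnitOfAmenable

variable {A P : Type u} [NonUnitalNormedRing A] [NormedSpace ℂ A]
  [NormedAddCommGroup P] [NormedSpace ℂ P] [CompleteSpace P]

/-- If the identity map is a derivation for some separately weak*-continuous bimodule structure
on a Connes-amenable dual Banach algebra `A`, then it is inner. -/
lemma IsConnesAmenable.exists_inner_id {𝒜 : DualBanachAlgebra A P} (h : 𝒜.IsConnesAmenable)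
    (X : Bimodule A A)
    (hl : ∀ a, Continuous[𝒜.wstar, 𝒜.wstar] fun b => X.left a b)
    (hl' : ∀ b, Continuous[𝒜.wstar, 𝒜.wstar] fun a => X.left a b)
    (hr : ∀ a, Continuous[𝒜.wstar, 𝒜.wstar] fun b => X.right a b)
    (hr' : ∀ b, Continuous[𝒜.wstar, 𝒜.wstar] fun a => X.right a b)
    (hD : ∀ a b, a * b = X.left a b + X.right b a) :
    ∃ e, ∀ a, a = X.left a e - X.right a e := by
  obtain ⟨F, hF⟩ : ∃ F : NormedSubspace (StrongDual ℂ A), F = 𝒜.ofPredual.range := ⟨_, rfl⟩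
  have : CompleteSpace F := by
    rw [hF]
    exact 𝒜.isClosed_range_ofPredual.completeSpace_coe
  have hmem : ∀ f, f ∈ F ↔ Continuous[𝒜.wstar, _] (fun a => f a) := fun f => by
    rw [hF, mem_range_ofPredual_iff]
  have hpF : ∀ p, 𝒜.ofPredual p ∈ F := fun p => (hmem _).2 (𝒜.continuous_ofPredual p)
  have hcomp : ∀ f ∈ F, ∀ T : A →L[ℂ] A, Continuous[𝒜.wstar, 𝒜.wstar] (fun a => T a) →
      Continuous[𝒜.wstar, _] fun a => f (T a) := by
    intro f hf T hT
    obtain ⟨p, rfl⟩ := 𝒜.exists_ofPredual_eq f ((hmem f).1 hf)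
    exact 𝒜.continuous_ofPredual_comp p hT
  let Y : Bimodule A F := X.dual.restrict F
    (fun a f hf => (hmem _).2 (hcomp f hf (X.right a) (hr a)))
    (fun a f hf => (hmem _).2 (hcomp f hf (X.left a) (hl a)))
  let D : A →L[ℂ] StrongDual ℂ F := F.subtypeL.flip
  have hrep : ∀ φ : StrongDual ℂ F, ∃ b : A, ∀ f : F, φ f = (f : StrongDual ℂ A) b := by
    intro φ
    refine ⟨𝒜.toDual.symm (φ ∘L 𝒜.ofPredual.codRestrict F hpF), ?_⟩
    rintro ⟨f, hf⟩
    obtain ⟨p, rfl⟩ := 𝒜.exists_ofPredual_eq f ((hmem f).1 hf)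
    simp only [ofPredual_apply, ContinuousLinearEquiv.apply_symm_apply]
    rfl
  have hY : 𝒜.IsNormalDual Y := by
    refine isNormalDual_iff.2 fun φ f => ?_
    obtain ⟨b, hb⟩ := hrep φ
    simp only [hb]
    exact ⟨hcomp f f.2 (X.left.flip b) (hl' b), hcomp f f.2 (X.right.flip b) (hr' b)⟩
  obtain ⟨φ, hφ⟩ := h F Y hY D
    (fun a b => by
      ext f
      change (f : StrongDual ℂ A) (a * b) = (f : StrongDual ℂ A) (X.left a b)
        + (f : StrongDual ℂ A) (X.right b a)
      rw [hD, map_add])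
    (𝒜.continuous_toWeakDual_iff.2 fun f => (hmem f).1 f.2)
  obtain ⟨e, he⟩ := hrep φ
  refine ⟨e, fun a => 𝒜.ofPredual_separates fun p => ?_⟩
  have := DFunLike.congr_fun (hφ a) (⟨𝒜.ofPredual p, hpF p⟩ : F)
  rw [sub_apply, Bimodule.dual_left_apply, Bimodule.dual_right_apply,
    he, he] at this
  rw [map_sub]
  exact this

/-- A Connes-amenable dual Banach algebra has an identity. -/
lemma IsConnesAmenable.exists_identity [IsScalarTower ℂ A A] [SMulCommClass ℂ A A]
    {𝒜 : DualBanachAlgebra A P} (h : 𝒜.IsConnesAmenable) :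
    ∃ e : A, ∀ a, e * a = a ∧ a * e = a := by
  have h0 : Continuous[𝒜.wstar, 𝒜.wstar] fun _ : A => (0 : A) :=
    @continuous_const A A 𝒜.wstar 𝒜.wstar 0
  obtain ⟨r, hr⟩ := h.exists_inner_id (leftRegular A) 𝒜.continuous_mul_left
    𝒜.continuous_mul_right (fun _ => h0) (fun _ => h0) (fun a b => by simp [leftRegular])
  obtain ⟨s, hs⟩ := h.exists_inner_id (rightRegular A) (fun _ => h0) (fun _ => h0)
    𝒜.continuous_mul_right 𝒜.continuous_mul_left (fun a b => by simp [rightRegular])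
  replace hr : ∀ a, a * r = a := fun a => by simpa [leftRegular] using (hr a).symm
  replace hs : ∀ a, -s * a = a := fun a => by simpa [rightRegular] using (hs a).symm
  have hrs : r = -s := by rw [← hs r, hr]
  exact ⟨r, fun a => ⟨by rw [hrs, hs], hr a⟩⟩

end UnitOfAmenable

/-! ### `σWC`-virtual diagonals -/

section VirtualDiagonal

variable {A P : Type*} [NonUnitalNormedRing A] [NormedSpace ℂ A]
  [IsScalarTower ℂ A A] [SMulCommClass ℂ A A] [CompleteSpace A]
  [NormedAddCommGroup P] [NormedSpace ℂ P]

/-- `M ∈ σWC((A ⊗̂ A)*)*` is a `σWC`-virtual diagonal with respect to the identity `e` of `A`: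
`a · M = M · a` for all `a`, and `π_σWC(M) = e`. -/
structure IsVirtualDiagonal (𝒜 : DualBanachAlgebra A P) (e : A) (M : StrongDual ℂ 𝒜.SWC) :
    Prop where
  left_eq_right : ∀ a, 𝒜.swcDual.left a M = 𝒜.swcDual.right a M
  piSWC_eq : 𝒜.piSWC M = e

/-- The bimodule `σWC((A ⊗̂ A)*)`. -/
abbrev swcBimodule (𝒜 : DualBanachAlgebra A P) : Bimodule A 𝒜.SWC :=
  𝒜.sigmaWCBimodule (ProjTensor.bimodule A).dual

lemma exists_right_piStar (𝒜 : DualBanachAlgebra A P) (a : A) (p : P) :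
    ∃ q, (∀ b, 𝒜.ofPredual q b = 𝒜.ofPredual p (a * b)) ∧
      𝒜.swcBimodule.right a (𝒜.piStar p) = 𝒜.piStar q := by
  obtain ⟨q, hq⟩ := 𝒜.exists_ofPredual_eq (𝒜.ofPredual p ∘L ContinuousLinearMap.mul ℂ A a)
    (𝒜.continuous_ofPredual_comp p (𝒜.continuous_mul_left a))
  refine ⟨q, fun b => by rw [hq]; rfl, Subtype.ext (ContinuousLinearMap.ext fun t => ?_)⟩
  change 𝒜.ofPredual p (mulMap A ((ProjTensor.bimodule A).left a t)) =
    𝒜.ofPredual q (mulMap A t)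
  rw [mulMap_left, hq]
  rfl

lemma exists_left_piStar (𝒜 : DualBanachAlgebra A P) (a : A) (p : P) :
    ∃ q, 𝒜.swcBimodule.left a (𝒜.piStar p) = 𝒜.piStar q := by
  obtain ⟨q, hq⟩ := 𝒜.exists_ofPredual_eq
    (𝒜.ofPredual p ∘L (ContinuousLinearMap.mul ℂ A).flip a)
    (𝒜.continuous_ofPredual_comp p (𝒜.continuous_mul_right a))
  refine ⟨q, Subtype.ext (ContinuousLinearMap.ext fun t => ?_)⟩
  change 𝒜.ofPredual p (mulMap A ((ProjTensor.bimodule A).right a t)) =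
    𝒜.ofPredual q (mulMap A t)
  rw [mulMap_right, hq]
  rfl

lemma piSWC_left (𝒜 : DualBanachAlgebra A P) (a : A) (M : StrongDual ℂ 𝒜.SWC) :
    𝒜.piSWC (𝒜.swcDual.left a M) = a * 𝒜.piSWC M := by
  refine 𝒜.ofPredual_separates fun p => ?_
  obtain ⟨q, hq, hpq⟩ := 𝒜.exists_right_piStar a p
  calc 𝒜.toDual (𝒜.piSWC (𝒜.swcDual.left a M)) p
      = (𝒜.swcDual.left a M) (𝒜.piStar p) := 𝒜.toDual_piSWC _ p
    _ = M (𝒜.swcBimodule.right a (𝒜.piStar p)) := 𝒜.swcBimodule.dual_left_apply a M _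
    _ = M (𝒜.piStar q) := congrArg M hpq
    _ = 𝒜.toDual (𝒜.piSWC M) q := (𝒜.toDual_piSWC M q).symm
    _ = 𝒜.ofPredual p (a * 𝒜.piSWC M) := hq _

/-- A virtual diagonal `M` gives the bimodule homomorphism `a ↦ a · M`. -/
lemma IsVirtualDiagonal.isConnesBiprojective {𝒜 : DualBanachAlgebra A P} {e : A}
    {M : StrongDual ℂ 𝒜.SWC} (hM : 𝒜.IsVirtualDiagonal e M) (he : ∀ a, a * e = a) :
    𝒜.IsConnesBiprojective :=
  ⟨𝒜.swcDual.left.flip M, fun a b => 𝒜.swcDual.left_mul a b M,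
    fun a b => 𝒜.swcDual.left_mul_of_central hM.left_eq_right a b,
    fun a => (𝒜.piSWC_left a M).trans (by rw [hM.piSWC_eq, he])⟩

lemma IsConnesBiprojective.exists_isVirtualDiagonal {𝒜 : DualBanachAlgebra A P}
    (h : 𝒜.IsConnesBiprojective) {e : A} (he : ∀ a, e * a = a ∧ a * e = a) :
    ∃ M, 𝒜.IsVirtualDiagonal e M := by
  obtain ⟨ρ, hl, hr, hρ⟩ := h
  refine ⟨ρ e, fun a => ?_, hρ e⟩
  rw [← hl, ← hr, (he a).1, (he a).2]

end VirtualDiagonal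

section DiagonalOfAmenable

variable {A P : Type u} [NonUnitalNormedRing A] [NormedSpace ℂ A]
  [NormedAddCommGroup P] [NormedSpace ℂ P]

/-- If the inner derivation of a functional `φ` vanishes on a closed sub-bimodule `K`, then it is
implemented by a functional that vanishes on `K`. -/
lemma IsConnesAmenable.exists_inner_annihilator {𝒜 : DualBanachAlgebra A P}
    (h : 𝒜.IsConnesAmenable) {E : Type u} [NormedAddCommGroup E] [NormedSpace ℂ E]
    [CompleteSpace E] {X : Bimodule A E} (hX : 𝒜.IsNormalDual X) (K : Submodule ℂ E)
    (hK : IsClosed (K : Set E))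
    (hl : ∀ a, ∀ x ∈ K, X.left a x ∈ K) (hr : ∀ a, ∀ x ∈ K, X.right a x ∈ K)
    (φ : StrongDual ℂ E) (hφ : ∀ a, ∀ x ∈ K, φ (X.right a x) = φ (X.left a x)) :
    ∃ ψ : StrongDual ℂ E, (∀ x ∈ K, ψ x = 0) ∧
      ∀ a, X.dual.left a φ - X.dual.right a φ = X.dual.left a ψ - X.dual.right a ψ := by
  let δ : A →L[ℂ] StrongDual ℂ E := X.dual.left.flip φ - X.dual.right.flip φ
  have hδ : ∀ a x, δ a x = φ (X.right a x) - φ (X.left a x) := fun a x => rfl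
  have hδK : ∀ a, K ≤ (δ a).ker := fun a x hx => by
    change δ a x = 0
    rw [hδ, hφ a x hx, sub_self]
  let D : A →L[ℂ] StrongDual ℂ (E ⧸ K) := LinearMap.mkContinuous
    { toFun := fun a => K.liftQL (δ a) (hδK a)
      map_add' := fun a b => by
        ext z
        obtain ⟨x, rfl⟩ := K.mkQ_surjective z
        exact DFunLike.congr_fun (map_add δ a b) x
      map_smul' := fun c a => by
        ext z
        obtain ⟨x, rfl⟩ := K.mkQ_surjective z
        exact DFunLike.congr_fun (map_smul δ c a) x }
    ‖δ‖ (fun a => ContinuousLinearMap.opNorm_le_bound _ (by positivity) fun z =>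
      (norm_liftQ_le K (δ a) (hδK a) z).trans (by gcongr; exact δ.le_opNorm a))
  obtain ⟨χ, hχ⟩ := h (E ⧸ K) (X.quotient K hl hr) (hX.quotient K hl hr) D
    (fun a b => by
      ext z
      obtain ⟨x, rfl⟩ := K.mkQ_surjective z
      change δ (a * b) x = δ b (X.right a x) + δ a (X.left b x)
      simp only [hδ, X.left_mul, X.right_mul, X.right_left]
      ring)
    (𝒜.continuous_toWeakDual_iff.2 fun z => by
      obtain ⟨x, rfl⟩ := K.mkQ_surjective z
      have h1 := isNormalDual_iff.1 hX φ x
      let _ := 𝒜.wstar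
      exact h1.1.sub h1.2)
  refine ⟨χ ∘L K.mkQL, fun x hx => ?_, fun a => ContinuousLinearMap.ext fun x => ?_⟩
  · rw [ContinuousLinearMap.comp_apply, Submodule.mkQL_apply, Submodule.mkQ_apply,
      (Submodule.Quotient.mk_eq_zero K).2 hx, map_zero]
  · exact DFunLike.congr_fun (hχ a) (K.mkQL x)

lemma exists_ofPredual_eq_orbit {𝒜 : DualBanachAlgebra A P} {F : Type*}
    [NormedAddCommGroup F] [NormedSpace ℂ F] {X : Bimodule A F}
    (hX : 𝒜.IsNormalDual X) (ψ : StrongDual ℂ F) (x : F) :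
    ∃ q, 𝒜.ofPredual q = ψ ∘L X.right.flip x :=
  𝒜.exists_ofPredual_eq _ (isNormalDual_iff.1 hX ψ x).1

variable [IsScalarTower ℂ A A] [SMulCommClass ℂ A A]

lemma IsConnesAmenable.exists_isVirtualDiagonal [CompleteSpace A] [CompleteSpace P]
    {𝒜 : DualBanachAlgebra A P} (h : 𝒜.IsConnesAmenable) {e : A} (he : ∀ a, e * a = a ∧ a * e = a) :
    ∃ M, 𝒜.IsVirtualDiagonal e M := by
  have : CompleteSpace 𝒜.SWC := (𝒜.isClosed_sigmaWC _).completeSpace_coe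
  let K : Submodule ℂ 𝒜.SWC := 𝒜.piStar.range.topologicalClosure
  have hinv : ∀ T : 𝒜.SWC →L[ℂ] 𝒜.SWC, (∀ p, ∃ q, T (𝒜.piStar p) = 𝒜.piStar q) →
      ∀ x ∈ K, T x ∈ K := by
    intro T hT x hx
    refine map_mem_closure T.continuous hx ?_
    rintro _ ⟨p, rfl⟩
    obtain ⟨q, hq⟩ := hT p
    exact ⟨q, hq.symm⟩
  let M₀ : StrongDual ℂ 𝒜.SWC :=
    (ContinuousLinearMap.apply ℂ ℂ (ProjTensor.tmul A e e)) ∘L (𝒜.sigmaWC _).subtypeL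
  have hM₀ : ∀ p, M₀ (𝒜.piStar p) = 𝒜.ofPredual p e := fun p => by
    change 𝒜.ofPredual p (mulMap A (ProjTensor.tmul A e e)) = _
    rw [mulMap_tmul, (he e).1]
  have hM₀K : ∀ a, ∀ x ∈ K, M₀ (𝒜.swcBimodule.right a x) = M₀ (𝒜.swcBimodule.left a x) := by
    intro a x hx
    refine closure_minimal (t := {x | M₀ (𝒜.swcBimodule.right a x) =
      M₀ (𝒜.swcBimodule.left a x)}) ?_ (isClosed_eq (by fun_prop) (by fun_prop)) hx
    rintro _ ⟨p, rfl⟩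
    change 𝒜.ofPredual p (mulMap A ((ProjTensor.bimodule A).left a (ProjTensor.tmul A e e))) =
      𝒜.ofPredual p (mulMap A ((ProjTensor.bimodule A).right a (ProjTensor.tmul A e e)))
    simp only [ProjTensor.bimodule_left_tmul, ProjTensor.bimodule_right_tmul, mulMap_tmul,
      (he _).1, (he _).2]
  obtain ⟨N, hNK, hN⟩ := h.exists_inner_annihilator (𝒜.isNormalDual_sigmaWCBimodule _) K
    (Submodule.isClosed_topologicalClosure _) (fun a => hinv _ (𝒜.exists_left_piStar a))
    (fun a => hinv _ fun p => (𝒜.exists_right_piStar a p).imp fun _ hq => hq.2) M₀ hM₀K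
  refine ⟨M₀ - N, fun a => ContinuousLinearMap.ext fun x => ?_,
    𝒜.ofPredual_separates fun p => ?_⟩
  · have h1 : M₀ (𝒜.swcBimodule.right a x) - M₀ (𝒜.swcBimodule.left a x) =
        N (𝒜.swcBimodule.right a x) - N (𝒜.swcBimodule.left a x) :=
      DFunLike.congr_fun (hN a) x
    change M₀ (𝒜.swcBimodule.right a x) - N (𝒜.swcBimodule.right a x) =
      M₀ (𝒜.swcBimodule.left a x) - N (𝒜.swcBimodule.left a x)
    linear_combination h1
  · have hp : N (𝒜.piStar p) = 0 := hNK _ (Submodule.le_topologicalClosure _ ⟨p, rfl⟩)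
    calc 𝒜.toDual (𝒜.piSWC (M₀ - N)) p = M₀ (𝒜.piStar p) - N (𝒜.piStar p) :=
        𝒜.toDual_piSWC _ p
      _ = 𝒜.ofPredual p e := by rw [hp, sub_zero, hM₀]

/-! ### Connes-amenability from a virtual diagonal -/

section AmenableOfDiagonal

variable {F : Type*} [NormedAddCommGroup F] [NormedSpace ℂ F]

/-- The map `x ↦ (a ⊗ b ↦ ⟨x, a · D(b)⟩)` from `F` to `(A ⊗̂ A)*`. -/
def coefficientMap (X : Bimodule A F) (D : A →L[ℂ] StrongDual ℂ F) :
    F →L[ℂ] StrongDual ℂ (ProjTensor A) :=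
  (ProjTensor.lift ((ContinuousLinearMap.compL ℂ A (StrongDual ℂ F) (StrongDual ℂ F)).flip D ∘L
    X.dual.left)).flip

lemma coefficientMap_tmul (X : Bimodule A F) (D : A →L[ℂ] StrongDual ℂ F) (x : F) (a b : A) :
    coefficientMap X D x (ProjTensor.tmul A a b) = D b (X.right a x) := by
  simp [coefficientMap]

lemma dual_right_coefficientMap (X : Bimodule A F) (D : A →L[ℂ] StrongDual ℂ F) (c : A) (x : F) :
    (ProjTensor.bimodule A).dual.right c (coefficientMap X D x) =
      coefficientMap X D (X.right c x) :=
  ProjTensor.ext_tmul fun a b => by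
    simp [coefficientMap_tmul, X.right_mul]

lemma dual_left_coefficientMap [CompleteSpace A] {X : Bimodule A F} {D : A →L[ℂ] StrongDual ℂ F}
    (hD : IsDerivation X.dual D) (c : A) (x : F) :
    (ProjTensor.bimodule A).dual.left c (coefficientMap X D x) =
      coefficientMap X D (X.left c x) + (D c ∘L X.right.flip x) ∘L mulMap A :=
  ProjTensor.ext_tmul fun a b => by
    simp [coefficientMap_tmul, X.right_mul, X.right_left, hD b c, add_comm]

variable [CompleteSpace A]

/-- Every element of `(A ⊗̂ A)**` acts on `π*(A_*)` as an element of `A`. -/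
lemma exists_apply_comp_mulMap (𝒜 : DualBanachAlgebra A P)
    (Φ : StrongDual ℂ (StrongDual ℂ (ProjTensor A))) :
    ∃ b : A, ∀ q, Φ (𝒜.ofPredual q ∘L mulMap A) = 𝒜.ofPredual q b := by
  refine ⟨𝒜.piSWC (Φ ∘L (𝒜.sigmaWC _).subtypeL), fun q => ?_⟩
  rw [ofPredual_apply, toDual_piSWC]
  rfl

lemma coefficientMap_mem_sigmaWC {𝒜 : DualBanachAlgebra A P} {X : Bimodule A F}
    (hX : 𝒜.IsNormalDual X) {D : A →L[ℂ] StrongDual ℂ F} (hD : IsDerivation X.dual D)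
    (hc : Continuous[𝒜.wstar, _] (fun a => StrongDual.toWeakDual (D a))) (x : F) :
    coefficientMap X D x ∈ 𝒜.sigmaWC (ProjTensor.bimodule A).dual := by
  refine mem_sigmaWC_of_forall (fun Φ => ?_) (fun Φ => ?_)
  · obtain ⟨b, hb⟩ := 𝒜.exists_apply_comp_mulMap Φ
    have h1 : ∀ c, Φ ((ProjTensor.bimodule A).dual.left c (coefficientMap X D x)) =
        (Φ ∘L coefficientMap X D) (X.left c x) + D c (X.right b x) := by
      intro c
      obtain ⟨q, hq⟩ := exists_ofPredual_eq_orbit hX (D c) x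
      rw [dual_left_coefficientMap hD, map_add, ← hq, hb, hq]
      rfl
    have h2 := (isNormalDual_iff.1 hX (Φ ∘L coefficientMap X D) x).2
    have h3 := 𝒜.continuous_toWeakDual_iff.1 hc (X.right b x)
    simp only [h1]
    let _ := 𝒜.wstar
    exact h2.add h3
  · simp only [dual_right_coefficientMap]
    exact (isNormalDual_iff.1 hX (Φ ∘L coefficientMap X D) x).1

/-- If `A` has a virtual diagonal, then `a ↦ e · D(a)` is inner for every weak*-continuous
derivation `D` into a normal dual bimodule. -/
lemma IsVirtualDiagonal.exists_inner {𝒜 : DualBanachAlgebra A P} {e : A}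
    {M : StrongDual ℂ 𝒜.SWC} (hM : 𝒜.IsVirtualDiagonal e M) {X : Bimodule A F}
    (hX : 𝒜.IsNormalDual X) {D : A →L[ℂ] StrongDual ℂ F} (hD : IsDerivation X.dual D)
    (hc : Continuous[𝒜.wstar, _] (fun a => StrongDual.toWeakDual (D a))) :
    ∃ φ : StrongDual ℂ F, ∀ a, X.dual.left e (D a) = X.dual.left a φ - X.dual.right a φ := by
  let θ : F →L[ℂ] 𝒜.SWC := (coefficientMap X D).codRestrict _ (coefficientMap_mem_sigmaWC hX hD hc)
  refine ⟨M ∘L θ, fun c => ContinuousLinearMap.ext fun x => ?_⟩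
  obtain ⟨q, hq⟩ := exists_ofPredual_eq_orbit hX (D c) x
  have hr : 𝒜.swcBimodule.right c (θ x) = θ (X.right c x) :=
    Subtype.ext (dual_right_coefficientMap X D c x)
  have hl : 𝒜.swcBimodule.left c (θ x) = θ (X.left c x) + 𝒜.piStar q := by
    refine Subtype.ext ((dual_left_coefficientMap hD c x).trans ?_)
    rw [← hq]
    rfl
  have hM' : M (𝒜.swcBimodule.right c (θ x)) = M (𝒜.swcBimodule.left c (θ x)) :=
    DFunLike.congr_fun (hM.left_eq_right c) (θ x)
  have hq' : M (𝒜.piStar q) = D c (X.right e x) := by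
    rw [← toDual_piSWC, hM.piSWC_eq, ← ofPredual_apply, hq]
    rfl
  rw [hr, hl, map_add, hq'] at hM'
  change D c (X.right e x) = M (θ (X.right c x)) - M (θ (X.left c x))
  linear_combination -hM'

/-- A dual Banach algebra with an identity and a virtual diagonal is Connes-amenable. -/
lemma IsVirtualDiagonal.isConnesAmenable {𝒜 : DualBanachAlgebra A P} {e : A}
    {M : StrongDual ℂ 𝒜.SWC} (hM : 𝒜.IsVirtualDiagonal e M)
    (he : ∀ a, e * a = a ∧ a * e = a) : 𝒜.IsConnesAmenable := by
  intro F _ _ _ X hX D hD hc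
  obtain ⟨φ, hφ⟩ := hM.exists_inner hX hD hc
  let Z := X.dual
  have hee : Z.right e (Z.left e (D e)) = 0 := by
    have h1 := congrArg (Z.left e) (hD e e)
    rw [(he e).1, map_add, ← Z.left_mul, (he e).1] at h1
    rw [Z.right_left]
    exact left_eq_add.1 h1
  refine ⟨φ - D e + Z.left e (D e), fun a => ?_⟩
  have h1 : D a = Z.left e (D a) + Z.right a (D e) := by
    conv_lhs => rw [← (he a).1]
    exact hD e a
  have h2 : Z.left a (Z.left e (D e)) = Z.left a (D e) := by rw [← Z.left_mul, (he a).2]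
  have h3 : Z.right a (Z.left e (D e)) = 0 := by
    rw [← (he a).1, Z.right_mul, hee, map_zero]
  change D a = Z.left a _ - Z.right a _
  rw [map_add, map_sub, map_add, map_sub, h2, h3, h1]
  have h4 : Z.left e (D a) = Z.left a φ - Z.right a φ := hφ a
  rw [h4]
  abel

end AmenableOfDiagonal

end DiagonalOfAmenable

end DualBanachAlgebra

lemma hasBoundedApproximateIdentity_of_identity {A : Type*} [NonUnitalNormedRing A] {e : A}
    (he : ∀ a, e * a = a ∧ a * e = a) : HasBoundedApproximateIdentity A := by
  refine ⟨pure e, ⟨fun m => ?_, fun m => ?_⟩, ‖e‖, by simp⟩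
  · simpa [(he m).2] using tendsto_pure_nhds (m * ·) e
  · simpa [(he m).1] using tendsto_pure_nhds (· * m) e

end ConnesBiproj

end

theorem mainTheorem1 {A P : Type u} [NonUnitalNormedRing A] [NormedSpace ℂ A]
    [IsScalarTower ℂ A A] [SMulCommClass ℂ A A] [CompleteSpace A]
    [NormedAddCommGroup P] [NormedSpace ℂ P] [CompleteSpace P]
    (𝒜 : ConnesBiproj.DualBanachAlgebra A P) :
    (𝒜.IsConnesBiprojective ∧ ConnesBiproj.HasBoundedApproximateIdentity A) ↔
      𝒜.IsConnesAmenable := by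
  constructor
  · rintro ⟨hb, hai⟩
    obtain ⟨e, he⟩ := 𝒜.exists_identity_of_approximateIdentity hai
    obtain ⟨M, hM⟩ := hb.exists_isVirtualDiagonal he
    exact hM.isConnesAmenable he
  · intro h
    obtain ⟨e, he⟩ := h.exists_identity
    obtain ⟨M, hM⟩ := h.exists_isVirtualDiagonal he
    exact ⟨hM.isConnesBiprojective fun a => (he a).2,
      ConnesBiproj.hasBoundedApproximateIdentity_of_identity he⟩
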